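/- Let $\ell^2(\mathbb{Z})$ be the complex Hilbert space of square-summable two-sided sequences with scalar product $\langle\cdot,\cdot\rangle$ linear in the first argument, and fix an orthonormal basis $(e_i)_{i\in\mathbb{Z}}$ of it. For a bounded operator $A$ on $\ell^2(\mathbb{Z})$ write $A_{i,j}=\langle Ae_j,e_i\rangle$, let $\operatorname{spec}(A)$ be its spectrum, and let $$N(A)=\operatorname{clos}\{\langle Ax,x\rangle : \|x\|=1\},\qquad \sqrt{N(A^2)}=\{z\in\mathbb{C} : z^2\in N(A^2)\}$$ be the (closed) numerical range of $A$ and the set of square roots of the points of the numerical range of $A^2$. Let $\sigma\in(0,1]$ and let $U_{-1}=\{1\}$, $U_0=\{0\}$, $U_1=\{\sigma,-\sigma\}$. Let $M(U_{-1},U_0,U_1)$ be the set of bounded operators $A$ on $\ell^2(\mathbb{Z})$ with $A_{i+k,i}\in U_k$ for $i\in\mathbb{Z}$, $k\in\{-1,0,1\}$ and $A_{i+k,i}=0$ for $i\in\mathbb{Z}$, $k\notin\{-1,0,1\}$, and let $M_{fin}(U_{-1},U_0,U_1)$ be the set of finite square matrices $B$ with the same property. An operator $A\in M(U_{-1},U_0,U_1)$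 is called pseudo-ergodic, written $A\in\Psi E(U_{-1},U_0,U_1)$, if for every $\varepsilon>0$ and every $B\in M_{fin}(U_{-1},U_0,U_1)$, of size $n\times n$ say, there is a $k\in\mathbb{Z}$ with $\|(A_{k+i,k+j})_{0\le i,j<n}-B\|\le\varepsilon$ in the Euclidean operator norm. (a) For every $A\in\Psi E(U_{-1},U_0,U_1)$, the set $\sqrt{N(A^2)}$ is a proper subset of $N(A)$; moreover $\operatorname{spec}(A)\subseteq\sqrt{N(A^2)}$ and $N(A)=\operatorname{conv}(\operatorname{spec}(A))$, and $\operatorname{spec}(A)$ is not convex. (b) In particular, the spectrum of the (generalized) Feinberg–Zee random hopping matrix is almost surely not convex: if $A$ is a random operator with values in $M(U_{-1},U_0,U_1)$ whose subdiagonal entries $A_{j+1,j}$, $j\in\mathbb{Z}$, are independent and identically distributed random variables taking each of the values $\sigma$ and $-\sigma$ with positive probability, then $\operatorname{spec}(A)$ is almost surely not convex. -/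

import Mathlib

open MeasureTheory ProbabilityTheory

noncomputable section

/-- The Hilbert space `ℓ²(ℤ)` of square-summable two-sided complex sequences. -/
abbrev EllTwoZ : Type := lp (fun _ : ℤ => ℂ) 2

/-- The matrix entry `A_{i,j} = ⟨A e_j, e_i⟩` with respect to the orthonormal basis `e`; the scalar
product of Mathlib is linear in its second argument. -/
def matrixEntry (e : HilbertBasis ℤ ℂ EllTwoZ) (A : EllTwoZ →L[ℂ] EllTwoZ) (i j : ℤ) : ℂ :=
  inner ℂ (e i) (A (e j))

/-- The set `M(U_n, …, U_m)` of bounded operators on `ℓ²(ℤ)` whose `k`-th diagonal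
`(A_{i+k,i})_i` has its entries in `U_k` for `n ≤ k ≤ m` and vanishes otherwise. -/
def bandOperators (e : HilbertBasis ℤ ℂ EllTwoZ) (n m : ℤ) (U : ℤ → Set ℂ) :
    Set (EllTwoZ →L[ℂ] EllTwoZ) :=
  {A | ∀ i k : ℤ,
    (n ≤ k ∧ k ≤ m → matrixEntry e A (i + k) i ∈ U k) ∧
    (¬ (n ≤ k ∧ k ≤ m) → matrixEntry e A (i + k) i = 0)}

/-- The set `M_fin(U_n, …, U_m)` of finite square matrices, here those of size `N`. -/
def bandMatrices (n m : ℤ) (U : ℤ → Set ℂ) (N : ℕ) : Set (Matrix (Fin N) (Fin N) ℂ) :=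
  {B | ∀ i j : Fin N,
    (n ≤ (i : ℤ) - (j : ℤ) ∧ (i : ℤ) - (j : ℤ) ≤ m → B i j ∈ U ((i : ℤ) - (j : ℤ))) ∧
    (¬ (n ≤ (i : ℤ) - (j : ℤ) ∧ (i : ℤ) - (j : ℤ) ≤ m) → B i j = 0)}

/-- The finite section `P_{k,l} A P_{k,l}` with `l = k + N - 1`, as a matrix of size `N`. -/
def finiteSection (e : HilbertBasis ℤ ℂ EllTwoZ) (A : EllTwoZ →L[ℂ] EllTwoZ) (k : ℤ) (N : ℕ) :
    Matrix (Fin N) (Fin N) ℂ :=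
  Matrix.of fun i j => matrixEntry e A (k + (i : ℤ)) (k + (j : ℤ))

/-- The set `ΨE(U_n, …, U_m)` of pseudo-ergodic operators: every matrix in `M_fin(U_n, …, U_m)` is
approximated, in the operator norm of the Euclidean space, by finite sections of `A`. -/
def pseudoErgodic (e : HilbertBasis ℤ ℂ EllTwoZ) (n m : ℤ) (U : ℤ → Set ℂ) :
    Set (EllTwoZ →L[ℂ] EllTwoZ) :=
  {A | A ∈ bandOperators e n m U ∧
    ∀ ε : ℝ, 0 < ε → ∀ N : ℕ, ∀ B ∈ bandMatrices n m U N, ∃ k : ℤ,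
      ‖Matrix.toEuclideanCLM (n := Fin N) (𝕜 := ℂ) (finiteSection e A k N - B)‖ ≤ ε}

/-- The (closed) numerical range `N(A) = clos {⟨A x, x⟩ : ‖x‖ = 1}`. -/
def numRange (A : EllTwoZ →L[ℂ] EllTwoZ) : Set ℂ :=
  closure {z | ∃ x : EllTwoZ, ‖x‖ = 1 ∧ z = inner ℂ x (A x)}

/-- The set `√N(A²) = {z : z² ∈ N(A²)}`. -/
def sqrtNumRangeSq (A : EllTwoZ →L[ℂ] EllTwoZ) : Set ℂ :=
  {z | z ^ 2 ∈ numRange (A ^ 2)}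

/-- The sets `U₋₁ = {1}`, `U₀ = {0}`, `U₁ = {σ, -σ}` of the hopping matrix; only the
indices `-1`, `0`, `1` are used. -/
def hoppingSets (σ : ℝ) (k : ℤ) : Set ℂ :=
  if k = -1 then {1} else if k = 0 then {0} else {(σ : ℂ), -(σ : ℂ)}

/-- `A` is the (generalized) Feinberg–Zee random hopping matrix: ones on the superdiagonal, zeros on
the main diagonal, and i.i.d. random variables on the subdiagonal which take both values `σ` and `-σ`
with positive probability and no other value. -/
structure IsRandomHoppingMatrix {Ω : Type*} [MeasurableSpace Ω]
    (e : HilbertBasis ℤ ℂ EllTwoZ) (σ : ℝ) (P : Measure Ω)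
    (A : Ω → EllTwoZ →L[ℂ] EllTwoZ) : Prop where
  mem : ∀ ω, A ω ∈ bandOperators e (-1) 1 (hoppingSets σ)
  measurable_entry : ∀ j : ℤ, Measurable fun ω => matrixEntry e (A ω) (j + 1) j
  indep : iIndepFun (fun (j : ℤ) ω => matrixEntry e (A ω) (j + 1) j) P
  identDistrib : ∀ j : ℤ, IdentDistrib (fun ω => matrixEntry e (A ω) (j + 1) j)
    (fun ω => matrixEntry e (A ω) (0 + 1) 0) P P
  pos_prob : 0 < P {ω | matrixEntry e (A ω) (0 + 1) 0 = (σ : ℂ)}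
  neg_prob : 0 < P {ω | matrixEntry e (A ω) (0 + 1) 0 = -(σ : ℂ)}

end

/-! Everything is read off support functions. For a direction `w`, put `h = max(|w + σ w̄|, |w - σ
w̄|)`. The matrix of the Hermitian part `wA + w̄A*` has two nonzero diagonals with entries of
modulus at most `h`, so its norm is at most `2h` and `Re(wz) ≤ h` on `N(A)`. Conversely,
pseudo-ergodicity provides arbitrarily long windows with constant subdiagonal `±σ`; truncated plane
waves there put the ellipses `ω̄ ± σω`, `|ω| = 1`, into the spectrum (`ellipse_subset_spectrum`),
and `h` is the support function of their union. Hence `N(A) = conv(spec(A))`.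

For `A²`, polarization of `⟨w²A²f, f⟩ = ⟨wAf, w̄A*f⟩` with a real parameter `τ` gives `Re((1 -
τi)w²z²) ≤ (1 + τ²)h²` when `z² ∈ N(A²)`. Taking `τ = Im(wz)/Re(wz)` recovers `Re(wz) ≤ h`, so
`√N(A²) ⊆ N(A)`.

The inclusion is strict. In the direction `w = 1 - i` both ellipses touch the same support line, so
`N(A)` contains the segment between the contact points. Near-equality in the bound for `A²` would
need the skew part to be almost `τi` times the Hermitian part; `diagonal_row_le` excludes this when
`τ = σ/(1 + σ²)`, and a point of the segment is lost. Since `spec(A) ⊆ √N(A²)` by spectral mapping,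
a convex spectrum would contradict strictness. The random case follows because every finite sign
pattern occurs almost surely, by Borel–Cantelli. -/

/-- In a finite-dimensional space the convex hull of a compact set is compact. -/
theorem IsCompact.convexHull_of_finiteDimensional {E : Type*} [NormedAddCommGroup E]
    [NormedSpace ℝ E] [FiniteDimensional ℝ E] {s : Set E} (hs : IsCompact s) :
    IsCompact (convexHull ℝ s) := by
  rcases s.eq_empty_or_nonempty with rfl | ⟨z₀, hz₀⟩
  · simp
  let κ := Fin (Module.finrank ℝ E + 1)
  have hK : IsCompact (stdSimplex ℝ κ ×ˢ Set.univ.pi fun _ : κ => s) :=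
    (isCompact_stdSimplex ℝ κ).prod (isCompact_univ_pi fun _ => hs)
  have hc : Continuous fun p : (κ → ℝ) × (κ → E) => ∑ j, p.1 j • p.2 j := by fun_prop
  convert hK.image hc using 1
  ext x
  constructor
  · intro hx
    obtain ⟨ι, _, z, w, hz, hind, hw, hw1, rfl⟩ := eq_pos_convex_span_of_mem_convexHull hx
    have hcard : Fintype.card ι ≤ Fintype.card κ := by
      rw [Fintype.card_fin]
      exact hind.card_le_finrank_succ.trans
        (Nat.succ_le_succ (Submodule.finrank_le _))
    -- The Carathéodory representation is padded to exactly `finrank + 1` points, with weight zero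
    -- at the extra copies of `z₀`.
    obtain ⟨f⟩ := Function.Embedding.nonempty_of_card_le hcard
    have hext : ∀ i, Function.extend f w 0 (f i) = w i := f.injective.extend_apply w 0
    have hext' : ∀ i, Function.extend f z (fun _ => z₀) (f i) = z i :=
      f.injective.extend_apply z _
    have hzero : ∀ j, j ∉ Set.range f → Function.extend f w 0 j = 0 := fun j hj =>
      Function.extend_apply' _ _ _ hj
    refine ⟨(Function.extend f w 0, Function.extend f z fun _ => z₀), ⟨⟨fun j => ?_, ?_⟩, ?_⟩, ?_⟩
    · by_cases hj : j ∈ Set.range f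
      · obtain ⟨i, rfl⟩ := hj
        simpa [hext] using (hw i).le
      · exact (hzero j hj).ge
    · rw [← hw1, Finset.sum_congr rfl fun i _ => (hext i).symm]
      exact (Fintype.sum_of_injective f f.injective _ _ hzero fun _ => rfl).symm
    · intro j _
      by_cases hj : j ∈ Set.range f
      · obtain ⟨i, rfl⟩ := hj
        simpa [hext'] using hz ⟨i, rfl⟩
      · simpa [Function.extend_apply' _ _ _ hj] using hz₀
    · refine (Fintype.sum_of_injective f f.injective _ _ (fun j hj => ?_)
        fun i => ?_).symm
      · simp [hzero j hj]
      · simp [hext, hext']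
  · rintro ⟨⟨w, z⟩, ⟨⟨hw0, hw1⟩, hz⟩, rfl⟩
    exact (convex_convexHull ℝ s).sum_mem (fun j _ => hw0 j) hw1
      fun j _ => subset_convexHull ℝ s (hz j trivial)

/-! ### Numerical ranges: convexity and relation to the spectrum. -/

section NumericalRange

variable {E : Type*} [NormedAddCommGroup E] [InnerProductSpace ℂ E]

theorem exists_norm_eq_one_im_mul_eq_zero (r : ℂ) : ∃ ω : ℂ, ‖ω‖ = 1 ∧ (ω * r).im = 0 := by
  by_cases hr : r = 0
  · exact ⟨1, by simp, by simp [hr]⟩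
  · refine ⟨(starRingEnd ℂ) r / ‖r‖, by simp [hr], ?_⟩
    rw [div_mul_eq_mul_div, mul_comm, Complex.mul_conj, ← Complex.ofReal_div, Complex.ofReal_im]

/-- The normalized case of Toeplitz–Hausdorff: rotating `y` by a phase makes the cross term real, so
the quadratic form is real along a path from `x` to a multiple of `y`. -/
theorem exists_norm_eq_one_inner_eq (T : E →L[ℂ] E) {x y : E} (hx : ‖x‖ = 1) (hy : ‖y‖ = 1)
    (hTx : inner ℂ x (T x) = 0) (hTy : inner ℂ y (T y) = 1) {b : ℝ} (hb0 : 0 ≤ b) (hb1 : b ≤ 1) :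
    ∃ v : E, ‖v‖ = 1 ∧ inner ℂ v (T v) = b := by
  obtain ⟨ω, hω, hr⟩ := exists_norm_eq_one_im_mul_eq_zero
    (inner ℂ x (T y) - (starRingEnd ℂ) (inner ℂ y (T x)))
  set s : ℂ := ω * inner ℂ x (T y) + (starRingEnd ℂ) ω * inner ℂ y (T x) with hs
  have hsre : s = (s.re : ℂ) := by
    apply Complex.ext <;> simp
    rw [hs]
    generalize inner ℂ x (T y) = p at hr
    generalize inner ℂ y (T x) = q at hr
    simp at hr ⊢
    linarith
  let g : ℝ → E := fun t => ((1 - t : ℝ) : ℂ) • x + ((t : ℂ) * ω) • y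
  have hωω : (starRingEnd ℂ) ω * ω = 1 := by
    rw [mul_comm, Complex.mul_conj, Complex.normSq_eq_norm_sq, hω]; simp
  have hg : ∀ t : ℝ, inner ℂ (g t) (T (g t)) = ((t ^ 2 + t * (1 - t) * s.re : ℝ) : ℂ) := by
    intro t
    have : inner ℂ (g t) (T (g t)) = (t : ℂ) ^ 2 * ((starRingEnd ℂ) ω * ω) + t * (1 - t) * s := by
      simp only [g, map_add, map_smul, inner_add_left, inner_add_right, inner_smul_left,
        inner_smul_right, hTx, hTy, map_mul, Complex.conj_ofReal, hs]
      push_cast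
      ring
    rw [this, hωω, hsre]
    push_cast
    simp
  have hcont : Continuous fun t : ℝ => t ^ 2 + t * (1 - t) * s.re - b * ‖g t‖ ^ 2 := by
    have : Continuous g := by fun_prop
    fun_prop
  have hivt := intermediate_value_Icc (zero_le_one' ℝ) hcont.continuousOn
  have h0 : ‖g 0‖ = 1 := by simp [g, hx]
  have h1 : ‖g 1‖ = 1 := by simp [g, hy, hω, norm_smul]
  obtain ⟨t, -, ht⟩ := hivt (show (0 : ℝ) ∈ _ by
    constructor
    · simp [h0, hb0]
    · simp [h1, hb1])
  -- If `g t = 0`, the form takes the same value on `tωy` as on `-(1 - t)x`, namely `0`; this forces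
  -- `t = 0`, but `g 0 = x` is a unit vector.
  have hgt : g t ≠ 0 := by
    intro h
    have h2 : (t : ℂ) * ω * ((starRingEnd ℂ) ((t : ℂ) * ω)) = 0 := by
      have h3 : ((t : ℂ) * ω) • y = -(((1 - t : ℝ) : ℂ) • x) := by
        rw [eq_neg_iff_add_eq_zero, add_comm]; exact h
      have h4 : inner ℂ (((t : ℂ) * ω) • y) (T (((t : ℂ) * ω) • y)) = 0 := by
        rw [h3]; simp [hTx, inner_smul_left, inner_smul_right]
      rw [map_smul, inner_smul_left, inner_smul_right, hTy] at h4
      linear_combination h4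
    have h5 : t = 0 := by
      have hω0 : ω ≠ 0 := by rintro rfl; simp at hω
      simpa [hω0] using h2
    rw [h5] at h
    rw [h, norm_zero] at h0
    exact zero_ne_one h0
  refine ⟨((‖g t‖⁻¹ : ℝ) : ℂ) • g t, ?_, ?_⟩
  · rw [norm_smul]; simp [hgt]
  · rw [map_smul, inner_smul_left, inner_smul_right, hg, Complex.conj_ofReal]
    norm_cast
    have : ‖g t‖ ≠ 0 := by simpa using hgt
    field_simp
    linarith

/-- The Toeplitz–Hausdorff theorem. -/
theorem convex_setOf_inner_map_self (T : E →L[ℂ] E) :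
    Convex ℝ {z : ℂ | ∃ x : E, ‖x‖ = 1 ∧ z = inner ℂ x (T x)} := by
  rintro _ ⟨x, hx, rfl⟩ _ ⟨y, hy, rfl⟩ a b ha hb hab
  by_cases hne : inner ℂ x (T x) = inner ℂ y (T y)
  · exact ⟨x, hx, by rw [← hne, ← add_smul, hab, one_smul]⟩
  set z₁ := inner ℂ x (T x)
  set z₂ := inner ℂ y (T y)
  have hd : z₂ - z₁ ≠ 0 := sub_ne_zero.2 (Ne.symm hne)
  let S : E →L[ℂ] E := (z₂ - z₁)⁻¹ • (T - z₁ • ContinuousLinearMap.id ℂ E)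
  have hS : ∀ v : E, ‖v‖ = 1 → inner ℂ v (S v) = (z₂ - z₁)⁻¹ * (inner ℂ v (T v) - z₁) := by
    intro v hv
    simp [S, inner_self_eq_norm_sq_to_K, hv]
  obtain ⟨v, hv, h⟩ := exists_norm_eq_one_inner_eq S hx hy (by rw [hS x hx]; simp [z₁])
    (by rw [hS y hy]; exact inv_mul_cancel₀ hd) hb (by linarith)
  refine ⟨v, hv, ?_⟩
  rw [hS v hv, inv_mul_eq_iff_eq_mul₀ hd] at h
  have ha' : (a : ℂ) = 1 - b := by rw [eq_sub_iff_add_eq]; exact_mod_cast hab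
  simp only [Complex.real_smul, ha']
  linear_combination -h

end NumericalRange

theorem convex_numRange (A : EllTwoZ →L[ℂ] EllTwoZ) : Convex ℝ (numRange A) :=
  (convex_setOf_inner_map_self A).closure

theorem re_mul_le_of_mem_numRange {A : EllTwoZ →L[ℂ] EllTwoZ} {c : ℂ} {M : ℝ}
    (h : ∀ x : EllTwoZ, (c * inner ℂ x (A x)).re ≤ M * ‖x‖ ^ 2) {z : ℂ} (hz : z ∈ numRange A) :
    (c * z).re ≤ M := by
  have hcl : IsClosed {z : ℂ | (c * z).re ≤ M} := isClosed_le (by fun_prop) continuous_const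
  refine closure_minimal ?_ hcl hz
  rintro _ ⟨x, hx, rfl⟩
  simpa [hx] using h x

/-- At distance `ε` from the numerical range, `z - A` is coercive with constant `ε`, hence
invertible. -/
theorem spectrum_subset_numRange (A : EllTwoZ →L[ℂ] EllTwoZ) : spectrum ℂ A ⊆ numRange A := by
  intro z hz
  by_contra hzn
  rw [numRange, Metric.mem_closure_iff] at hzn
  push Not at hzn
  obtain ⟨ε, hε, h⟩ := hzn
  refine hz (ContinuousLinearMap.isUnit_of_forall_le_norm_inner_map _ (c := ⟨ε, hε.le⟩) hε ?_)
  intro x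
  rcases eq_or_ne x 0 with rfl | hx
  · simp
  have hx' : ‖x‖ ≠ 0 := by simpa using hx
  have hx2 : 0 < ‖x‖ ^ 2 := by positivity
  have h1 := h _ ⟨((‖x‖⁻¹ : ℝ) : ℂ) • x, by rw [norm_smul]; simp [hx], rfl⟩
  rw [dist_eq_norm, map_smul, inner_smul_left, inner_smul_right, Complex.conj_ofReal] at h1
  have h2 : inner ℂ ((algebraMap ℂ (EllTwoZ →L[ℂ] EllTwoZ) z - A) x) x
      = (starRingEnd ℂ) (z * (‖x‖ : ℂ) ^ 2 - inner ℂ x (A x)) := by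
    rw [← inner_conj_symm]
    congr 1
    simp [Algebra.algebraMap_eq_smul_one, inner_sub_right, inner_smul_right,
      inner_self_eq_norm_sq_to_K]
  rw [h2, RCLike.norm_conj]
  have h3 : z * (‖x‖ : ℂ) ^ 2 - inner ℂ x (A x)
      = ((‖x‖ ^ 2 : ℝ) : ℂ) * (z - ((‖x‖⁻¹ : ℝ) : ℂ) * (((‖x‖⁻¹ : ℝ) : ℂ) * inner ℂ x (A x))) := by
    have : (‖x‖ : ℂ) ≠ 0 := by exact_mod_cast hx'
    push_cast
    field_simp
  rw [h3, norm_mul, Complex.norm_real, Real.norm_of_nonneg hx2.le]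
  exact mul_le_mul_of_nonneg_left h1 hx2.le

theorem convexHull_spectrum_subset_numRange (A : EllTwoZ →L[ℂ] EllTwoZ) :
    convexHull ℝ (spectrum ℂ A) ⊆ numRange A :=
  convexHull_min (spectrum_subset_numRange A) (convex_numRange A)

theorem spectrum_subset_sqrtNumRangeSq (A : EllTwoZ →L[ℂ] EllTwoZ) :
    spectrum ℂ A ⊆ sqrtNumRangeSq A := fun _ hz =>
  spectrum_subset_numRange (A ^ 2) (spectrum.pow_mem_pow A 2 hz)

/-- A point on the far side of a real line from the spectrum, for a point outside its hull. -/
theorem exists_re_mul_lt_of_notMem_convexHull_spectrum {A : EllTwoZ →L[ℂ] EllTwoZ} {z : ℂ}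
    (hz : z ∉ convexHull ℝ (spectrum ℂ A)) :
    ∃ w : ℂ, ∀ μ ∈ spectrum ℂ A, (w * μ).re < (w * z).re := by
  have hc : IsCompact (convexHull ℝ (spectrum ℂ A)) :=
    (spectrum.isCompact A).convexHull_of_finiteDimensional
  obtain ⟨l, u, hl, hu⟩ := geometric_hahn_banach_closed_point (convex_convexHull ℝ _)
    hc.isClosed hz
  have hlw : ∀ ζ : ℂ, l ζ = (((l 1 : ℝ) - (l Complex.I : ℝ) * Complex.I) * ζ).re := by
    intro ζ
    have : ζ = ζ.re • (1 : ℂ) + ζ.im • Complex.I := by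
      simp [Complex.re_add_im]
    conv_lhs => rw [this, map_add, map_smul, map_smul]
    simp
    ring
  refine ⟨(l 1 : ℝ) - (l Complex.I : ℝ) * Complex.I, fun μ hμ => ?_⟩
  rw [← hlw, ← hlw]
  exact (hl μ (subset_convexHull ℝ _ hμ)).trans hu

/-! ### Coordinates, tridiagonal action and sign patterns. -/

section Coordinates

variable (e : HilbertBasis ℤ ℂ EllTwoZ)

theorem hasSum_norm_inner_sq (f : EllTwoZ) :
    HasSum (fun i => ‖inner ℂ (e i) f‖ ^ 2) (‖f‖ ^ 2) := by
  have h := e.hasSum_inner_mul_inner f f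
  rw [inner_self_eq_norm_sq_to_K] at h
  have h2 : ∀ i, inner ℂ f (e i) * inner ℂ (e i) f = ((‖inner ℂ (e i) f‖ ^ 2 : ℝ) : ℂ) := by
    intro i
    rw [← inner_conj_symm, mul_comm, Complex.mul_conj, Complex.normSq_eq_norm_sq]
  simp only [h2] at h
  exact Complex.hasSum_ofReal.1 (by simpa using h)

theorem hasSum_norm_inner_shift_sq (f : EllTwoZ) (k : ℤ) :
    HasSum (fun i => ‖inner ℂ (e (i + k)) f‖ ^ 2) (‖f‖ ^ 2) :=
  (Equiv.addRight k).hasSum_iff.2 (hasSum_norm_inner_sq e f)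

theorem inner_apply_eq_of_tridiagonal (T : EllTwoZ →L[ℂ] EllTwoZ) (i : ℤ)
    (h0 : matrixEntry e T i i = 0)
    (h : ∀ j, j ≠ i - 1 → j ≠ i → j ≠ i + 1 → matrixEntry e T i j = 0) (f : EllTwoZ) :
    inner ℂ (e i) (T f) = matrixEntry e T i (i + 1) * inner ℂ (e (i + 1)) f
      + matrixEntry e T i (i - 1) * inner ℂ (e (i - 1)) f := by
  have h1 := ((e.hasSum_repr f).mapL T).mapL (innerSL ℂ (e i))
  simp only [map_smul, innerSL_apply_apply, smul_eq_mul, e.repr_apply_apply] at h1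
  have h2 : HasSum (fun j => inner ℂ (e j) f * inner ℂ (e i) (T (e j))) _ :=
    hasSum_sum_of_ne_finset_zero (s := {i + 1, i - 1}) (by
      intro j hj
      simp only [Finset.mem_insert, Finset.mem_singleton, not_or] at hj
      have : inner ℂ (e i) (T (e j)) = 0 := by
        by_cases hji : j = i
        · rw [hji]; exact h0
        · exact h j hj.2 hji hj.1
      rw [this, mul_zero])
  rw [h1.unique h2, Finset.sum_pair (by omega)]
  simp only [matrixEntry]
  ring

theorem matrixEntry_adjoint (T : EllTwoZ →L[ℂ] EllTwoZ) (i j : ℤ) :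
    matrixEntry e (ContinuousLinearMap.adjoint T) i j = (starRingEnd ℂ) (matrixEntry e T j i) := by
  rw [matrixEntry, ContinuousLinearMap.adjoint_inner_right, matrixEntry, inner_conj_symm]

end Coordinates

/-- In the coordinates of `e`, the operator `A` acts as
`(A f)_i = f_{i+1} + s_{i-1} f_{i-1}` and its adjoint accordingly. -/
structure IsHoppingOperator (e : HilbertBasis ℤ ℂ EllTwoZ) (σ : ℝ) (s : ℤ → ℝ)
    (A : EllTwoZ →L[ℂ] EllTwoZ) : Prop where
  sign (i : ℤ) : s i = σ ∨ s i = -σ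
  inner_apply (f : EllTwoZ) (i : ℤ) : inner ℂ (e i) (A f)
    = inner ℂ (e (i + 1)) f + s (i - 1) * inner ℂ (e (i - 1)) f
  inner_adjoint (f : EllTwoZ) (i : ℤ) : inner ℂ (e i) (ContinuousLinearMap.adjoint A f)
    = s i * inner ℂ (e (i + 1)) f + inner ℂ (e (i - 1)) f
  matrixEntry_sub (i : ℤ) : matrixEntry e A (i + 1) i = s i

section Band

variable {e : HilbertBasis ℤ ℂ EllTwoZ} {σ : ℝ} {A : EllTwoZ →L[ℂ] EllTwoZ}

theorem matrixEntry_sub_eq_or (hA : A ∈ bandOperators e (-1) 1 (hoppingSets σ)) (i : ℤ) :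
    matrixEntry e A (i + 1) i = (σ : ℂ) ∨ matrixEntry e A (i + 1) i = -(σ : ℂ) := by
  simpa [hoppingSets] using (hA i 1).1 (by norm_num)

theorem matrixEntry_super (hA : A ∈ bandOperators e (-1) 1 (hoppingSets σ)) (i : ℤ) :
    matrixEntry e A i (i + 1) = 1 := by
  simpa [hoppingSets] using (hA (i + 1) (-1)).1 (by norm_num)

theorem matrixEntry_diag (hA : A ∈ bandOperators e (-1) 1 (hoppingSets σ)) (i : ℤ) :
    matrixEntry e A i i = 0 := by
  simpa [hoppingSets] using (hA i 0).1 (by norm_num)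

theorem matrixEntry_off (hA : A ∈ bandOperators e (-1) 1 (hoppingSets σ)) {i j : ℤ}
    (h1 : j ≠ i - 1) (h0 : j ≠ i) (h2 : j ≠ i + 1) : matrixEntry e A i j = 0 := by
  simpa using (hA j (i - j)).2 (by omega)

theorem exists_isHoppingOperator (hA : A ∈ bandOperators e (-1) 1 (hoppingSets σ)) :
    ∃ s : ℤ → ℝ, IsHoppingOperator e σ s A := by
  have hs : ∀ i, ∃ r : ℝ, (r = σ ∨ r = -σ) ∧ matrixEntry e A (i + 1) i = r := by
    intro i
    rcases matrixEntry_sub_eq_or hA i with h | h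
    · exact ⟨σ, Or.inl rfl, h⟩
    · exact ⟨-σ, Or.inr rfl, by rw [h]; simp⟩
  choose s hs1 hs2 using hs
  refine ⟨s, hs1, fun f i => ?_, fun f i => ?_, hs2⟩
  · rw [inner_apply_eq_of_tridiagonal e A i (matrixEntry_diag hA i)
      (fun j h1 h0 h2 => matrixEntry_off hA h1 h0 h2), matrixEntry_super hA, ← hs2]
    simp
  · rw [inner_apply_eq_of_tridiagonal e _ i (by simp [matrixEntry_adjoint, matrixEntry_diag hA])
      (fun j h1 h0 h2 => by
        rw [matrixEntry_adjoint, matrixEntry_off hA (by omega) (by omega) (by omega), map_zero]),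
      matrixEntry_adjoint, matrixEntry_adjoint, hs2]
    have := matrixEntry_super hA (i - 1)
    rw [sub_add_cancel] at this
    simp [this]

theorem norm_matrix_apply_le {N : ℕ} (M : Matrix (Fin N) (Fin N) ℂ) (i j : Fin N) :
    ‖M i j‖ ≤ ‖Matrix.toEuclideanCLM (n := Fin N) (𝕜 := ℂ) M‖ := by
  have h := (Matrix.toEuclideanCLM (n := Fin N) (𝕜 := ℂ) M).le_opNorm
    (EuclideanSpace.single j (1 : ℂ))
  rw [PiLp.norm_single, norm_one, mul_one] at h
  refine le_trans ?_ h
  have h2 := PiLp.norm_apply_le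
    (Matrix.toEuclideanCLM (n := Fin N) (𝕜 := ℂ) M (EuclideanSpace.single j (1 : ℂ))) i
  refine le_of_eq_of_le ?_ h2
  rw [Matrix.ofLp_toEuclideanCLM]
  simp

/-- The finite matrix with ones above the diagonal and `c` below it. -/
def hoppingMatrix (N : ℕ) (c : ℕ → ℝ) : Matrix (Fin N) (Fin N) ℂ :=
  Matrix.of fun i j => if (i : ℕ) + 1 = j then 1 else if (i : ℕ) = j + 1 then (c j : ℂ) else 0

theorem hoppingMatrix_mem {N : ℕ} {c : ℕ → ℝ} (hc : ∀ j, c j = σ ∨ c j = -σ) :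
    hoppingMatrix N c ∈ bandMatrices (-1) 1 (hoppingSets σ) N := by
  intro i j
  refine ⟨fun h => ?_, fun h => ?_⟩
  · simp only [hoppingSets, hoppingMatrix, Matrix.of_apply]
    split_ifs <;> first | omega | simp
    rcases hc j with h | h <;> simp [h]
  · simp only [hoppingMatrix, Matrix.of_apply]
    rw [if_neg (by omega), if_neg (by omega)]

/-- Every finite sign pattern occurs along the subdiagonal of a pseudo-ergodic operator. -/
theorem exists_pattern_of_mem_pseudoErgodic (hσ : 0 < σ)
    (hA : A ∈ pseudoErgodic e (-1) 1 (hoppingSets σ)) {s : ℤ → ℝ} (hs : IsHoppingOperator e σ s A)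
    (N : ℕ) {c : ℕ → ℝ} (hc : ∀ j, c j = σ ∨ c j = -σ) :
    ∃ k : ℤ, ∀ j : ℕ, j < N → s (k + j) = c j := by
  -- Distinct signs differ by `2σ`, so tolerance `σ` forces equality. A matrix of size `N + 1` has
  -- `N` subdiagonal entries.
  obtain ⟨k, hk⟩ := hA.2 σ hσ (N + 1) _ (hoppingMatrix_mem (N := N + 1) hc)
  refine ⟨k, fun j hj => ?_⟩
  have h := (norm_matrix_apply_le _ ⟨j + 1, by omega⟩ ⟨j, by omega⟩).trans hk
  simp only [Matrix.sub_apply, finiteSection, hoppingMatrix, Matrix.of_apply] at h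
  rw [if_neg (by omega), if_pos (by trivial)] at h
  have h2 : k + ((j + 1 : ℕ) : ℤ) = k + j + 1 := by push_cast; ring
  rw [h2, hs.matrixEntry_sub, ← Complex.ofReal_sub, Complex.norm_real, Real.norm_eq_abs,
    abs_le] at h
  rcases hs.sign (k + j) with h3 | h3 <;> rcases hc j with h4 | h4 <;> rw [h3, h4] at h ⊢ <;>
    linarith [h.1, h.2]

/-- An operator all of whose sign patterns occur along the subdiagonal is pseudo-ergodic. -/
theorem mem_pseudoErgodic_of_exists_pattern (hA : A ∈ bandOperators e (-1) 1 (hoppingSets σ))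
    (h : ∀ (N : ℕ) (c : Fin N → ℂ), (∀ j, c j = (σ : ℂ) ∨ c j = -(σ : ℂ)) →
      ∃ k : ℤ, ∀ j : Fin N, matrixEntry e A (k + j + 1) (k + j) = c j) :
    A ∈ pseudoErgodic e (-1) 1 (hoppingSets σ) := by
  refine ⟨hA, fun ε hε N B hB => ?_⟩
  -- The subdiagonal entry of the last column lies outside the window; `σ` is an arbitrary filler.
  obtain ⟨k, hk⟩ := h N (fun j => if hj : (j : ℕ) + 1 < N then B ⟨j + 1, hj⟩ j else σ) (by
    intro j
    split_ifs with hj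
    · simpa [hoppingSets] using (hB ⟨j + 1, hj⟩ j).1 (by simp)
    · exact Or.inl rfl)
  refine ⟨k, le_of_eq_of_le ?_ hε.le⟩
  have : finiteSection e A k N = B := by
    ext i j
    simp only [finiteSection, Matrix.of_apply]
    by_cases h1 : (i : ℤ) = j + 1
    · have := hk j
      rw [dif_pos (by omega)] at this
      rw [h1, ← add_assoc, this]
      congr 1
      ext
      simp; omega
    by_cases h2 : (j : ℤ) = i + 1
    · rw [h2, ← add_assoc, matrixEntry_super hA]
      have := (hB i j).1 (by omega)
      rw [h2] at this
      simpa [hoppingSets, eq_comm] using this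
    by_cases h3 : (i : ℤ) = j
    · rw [h3, matrixEntry_diag hA]
      have := (hB i j).1 (by omega)
      rw [h3] at this
      simpa [hoppingSets, eq_comm] using this
    · rw [matrixEntry_off hA (by omega) (by omega) (by omega), (hB i j).2 (by omega)]
  rw [this, sub_self, map_zero, norm_zero]

end Band

/-! ### Upper bounds for the support functions of `N(A)` and `√N(A²)`. -/

open ComplexConjugate

section HermitianPart

theorem inner_self_eq_ofReal_norm_sq (x : EllTwoZ) : inner ℂ x x = ((‖x‖ ^ 2 : ℝ) : ℂ) := by
  simp

/-- Polarization, completed to a square in `τ`: discarding the last term costs nothing exactly when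
`a - b = τi(a + b)`. -/
theorem re_one_sub_mul_inner (a b : EllTwoZ) (τ : ℝ) :
    4 * ((1 - τ * Complex.I) * inner ℂ b a).re
      = (1 + τ ^ 2) * ‖a + b‖ ^ 2 - ‖a - b - (τ * Complex.I) • (a + b)‖ ^ 2 := by
  have h1 : ∀ x : EllTwoZ, ‖x‖ ^ 2 = (inner ℂ x x).re := fun x => by
    rw [inner_self_eq_ofReal_norm_sq, Complex.ofReal_re]
  have h2 : inner ℂ a b = conj (inner ℂ b a) := (inner_conj_symm a b).symm
  rw [h1, h1]
  simp only [inner_add_left, inner_add_right, inner_sub_left, inner_sub_right, inner_smul_left,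
    inner_smul_right, h2]
  have ha : (inner ℂ a a).im = 0 := by simpa using inner_self_im (𝕜 := ℂ) a
  have hb : (inner ℂ b b).im = 0 := by simpa using inner_self_im (𝕜 := ℂ) b
  generalize inner ℂ a a = p at ha ⊢
  generalize inner ℂ b b = q at hb ⊢
  generalize inner ℂ b a = r
  simp [ha, hb]
  ring

theorem re_mul_le_of_mem_numRange_sq {A : EllTwoZ →L[ℂ] EllTwoZ} {w : ℂ} {τ M : ℝ}
    (h : ∀ f : EllTwoZ,
      (1 + τ ^ 2) * ‖w • A f + conj w • ContinuousLinearMap.adjoint A f‖ ^ 2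
        - ‖w • A f - conj w • ContinuousLinearMap.adjoint A f - (τ * Complex.I) •
          (w • A f + conj w • ContinuousLinearMap.adjoint A f)‖ ^ 2 ≤ 4 * (M * ‖f‖ ^ 2))
    {z : ℂ} (hz : z ∈ numRange (A ^ 2)) : ((1 - τ * Complex.I) * (w ^ 2 * z)).re ≤ M := by
  rw [← mul_assoc]
  refine re_mul_le_of_mem_numRange (fun f => ?_) hz
  have h1 := h f
  rw [← re_one_sub_mul_inner] at h1
  have h2 : inner ℂ (conj w • ContinuousLinearMap.adjoint A f) (w • A f)
      = w ^ 2 * inner ℂ f ((A ^ 2) f) := by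
    rw [inner_smul_left, inner_smul_right, ContinuousLinearMap.adjoint_inner_left,
      Complex.conj_conj, pow_two A, mul_apply_eq_comp]
    ring
  rw [h2, ← mul_assoc] at h1
  linarith

end HermitianPart

/-- Reduces quadratic estimates to single rows; the factor 2 comes from summing the two shifts of
`f`. -/
theorem norm_sq_sub_norm_sq_le_of_inner (e : HilbertBasis ℤ ℂ EllTwoZ) {a b C : ℝ}
    {u v f : EllTwoZ}
    (h : ∀ i, a * ‖inner ℂ (e i) u‖ ^ 2 - b * ‖inner ℂ (e i) v‖ ^ 2
      ≤ C * (‖inner ℂ (e (i + 1)) f‖ ^ 2 + ‖inner ℂ (e (i - 1)) f‖ ^ 2)) :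
    a * ‖u‖ ^ 2 - b * ‖v‖ ^ 2 ≤ C * (2 * ‖f‖ ^ 2) := by
  have h1 := ((hasSum_norm_inner_sq e u).mul_left a).sub ((hasSum_norm_inner_sq e v).mul_left b)
  have h2 := ((hasSum_norm_inner_shift_sq e f 1).add
    (hasSum_norm_inner_shift_sq e f (-1))).mul_left C
  rw [← two_mul] at h2
  exact hasSum_le h h1 h2

namespace IsHoppingOperator

variable {e : HilbertBasis ℤ ℂ EllTwoZ} {σ : ℝ} {s : ℤ → ℝ} {A : EllTwoZ →L[ℂ] EllTwoZ}

theorem inner_hermitian_part (hs : IsHoppingOperator e σ s A) (w : ℂ) (f : EllTwoZ) (i : ℤ) :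
    inner ℂ (e i) (w • A f + conj w • ContinuousLinearMap.adjoint A f)
      = (w + conj w * s i) * inner ℂ (e (i + 1)) f
        + (conj w + w * s (i - 1)) * inner ℂ (e (i - 1)) f := by
  rw [inner_add_right, inner_smul_right, inner_smul_right, hs.inner_apply, hs.inner_adjoint]
  ring

theorem inner_skew_part (hs : IsHoppingOperator e σ s A) (w : ℂ) (f : EllTwoZ) (i : ℤ) :
    inner ℂ (e i) (w • A f - conj w • ContinuousLinearMap.adjoint A f)
      = (w - conj w * s i) * inner ℂ (e (i + 1)) f
        + (w * s (i - 1) - conj w) * inner ℂ (e (i - 1)) f := by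
  rw [inner_sub_right, inner_smul_right, inner_smul_right, hs.inner_apply, hs.inner_adjoint]
  ring

theorem norm_offDiagonal_le (hs : IsHoppingOperator e σ s A) {w : ℂ} {h : ℝ}
    (h1 : ‖w + σ * conj w‖ ≤ h) (h2 : ‖w - σ * conj w‖ ≤ h) (i : ℤ) : ‖w + conj w * s i‖ ≤ h := by
  rcases hs.sign i with hi | hi <;> rw [hi]
  · rwa [mul_comm]
  · rw [mul_comm, Complex.ofReal_neg, neg_mul, ← sub_eq_add_neg]
    exact h2

theorem norm_hermitian_part_sq_le (hs : IsHoppingOperator e σ s A) {w : ℂ} {h : ℝ}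
    (h1 : ‖w + σ * conj w‖ ≤ h) (h2 : ‖w - σ * conj w‖ ≤ h) (f : EllTwoZ) :
    ‖w • A f + conj w • ContinuousLinearMap.adjoint A f‖ ^ 2 ≤ 4 * (h ^ 2 * ‖f‖ ^ 2) := by
  have key := norm_sq_sub_norm_sq_le_of_inner e (a := 1) (b := 0) (C := 2 * h ^ 2)
    (u := w • A f + conj w • ContinuousLinearMap.adjoint A f) (v := 0) (f := f) (fun i => by
      rw [hs.inner_hermitian_part]
      generalize inner ℂ (e (i + 1)) f = x
      generalize inner ℂ (e (i - 1)) f = y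
      have hp : ‖(w + conj w * s i) * x‖ ≤ h * ‖x‖ := by
        rw [norm_mul]
        exact mul_le_mul_of_nonneg_right (hs.norm_offDiagonal_le h1 h2 i) (norm_nonneg _)
      have hq : ‖(conj w + w * s (i - 1)) * y‖ ≤ h * ‖y‖ := by
        rw [norm_mul]
        refine mul_le_mul_of_nonneg_right ?_ (norm_nonneg _)
        have := hs.norm_offDiagonal_le h1 h2 (i - 1)
        rwa [← RCLike.norm_conj, map_add, map_mul, Complex.conj_conj, Complex.conj_ofReal] at this
      have hpq := norm_add_le ((w + conj w * s i) * x) ((conj w + w * s (i - 1)) * y)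
      have h3 : ‖(w + conj w * s i) * x + (conj w + w * s (i - 1)) * y‖ ^ 2
          ≤ (h * ‖x‖ + h * ‖y‖) ^ 2 :=
        pow_le_pow_left₀ (norm_nonneg _) (by linarith) 2
      nlinarith [sq_nonneg (h * ‖x‖ - h * ‖y‖)])
  linarith

theorem re_mul_le_of_mem_numRange (hs : IsHoppingOperator e σ s A) {w : ℂ} {h : ℝ}
    (h1 : ‖w + σ * conj w‖ ≤ h) (h2 : ‖w - σ * conj w‖ ≤ h) {z : ℂ} (hz : z ∈ numRange A) :
    (w * z).re ≤ h := by
  have h0 : 0 ≤ h := (norm_nonneg _).trans h1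
  refine _root_.re_mul_le_of_mem_numRange (fun f => ?_) hz
  have hn : ‖w • A f + conj w • ContinuousLinearMap.adjoint A f‖ ≤ 2 * h * ‖f‖ := by
    refine le_of_sq_le_sq ?_ (by positivity)
    exact (hs.norm_hermitian_part_sq_le h1 h2 f).trans_eq (by ring)
  have h3 : (inner ℂ f (w • A f + conj w • ContinuousLinearMap.adjoint A f)).re
      = 2 * (w * inner ℂ f (A f)).re := by
    rw [inner_add_right, inner_smul_right, inner_smul_right,
      ContinuousLinearMap.adjoint_inner_right, ← inner_conj_symm (A f) f, ← map_mul,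
      Complex.add_re, Complex.conj_re]
    ring
  have h4 := (Complex.re_le_norm _).trans
    (norm_inner_le_norm (𝕜 := ℂ) f (w • A f + conj w • ContinuousLinearMap.adjoint A f))
  rw [h3] at h4
  nlinarith [mul_le_mul_of_nonneg_left hn (norm_nonneg f)]

theorem re_mul_le_of_sq_mem_numRange_sq (hs : IsHoppingOperator e σ s A) {w : ℂ} {h : ℝ}
    (h1 : ‖w + σ * conj w‖ ≤ h) (h2 : ‖w - σ * conj w‖ ≤ h) {z : ℂ} (hz : z ∈ sqrtNumRangeSq A) :
    (w * z).re ≤ h := by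
  have h0 : 0 ≤ h := (norm_nonneg _).trans h1
  by_contra! hlt
  set x := (w * z).re with hx
  set y := (w * z).im with hy
  have hx0 : 0 < x := h0.trans_lt hlt
  -- With `wz = x(1 + τi)`, the number `(1 - τi)(wz)²` has real part `(1 + τ²)x²`, so the factor `1
  -- + τ²` cancels.
  have key := re_mul_le_of_mem_numRange_sq (A := A) (w := w) (τ := y / x)
    (M := (1 + (y / x) ^ 2) * h ^ 2) (fun f => by
      have := mul_le_mul_of_nonneg_left (hs.norm_hermitian_part_sq_le h1 h2 f)
        (show 0 ≤ 1 + (y / x) ^ 2 by positivity)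
      refine (sub_le_self _ (sq_nonneg _)).trans (this.trans_eq (by ring))) hz
  have hxy : w * z = x + y * Complex.I := (Complex.re_add_im _).symm
  have h3 : ((1 - ((y / x : ℝ) : ℂ) * Complex.I) * (w ^ 2 * z ^ 2)).re
      = (1 + (y / x) ^ 2) * x ^ 2 := by
    rw [← mul_pow, hxy]
    simp [pow_two]
    field_simp
    ring
  rw [h3] at key
  have := le_of_mul_le_mul_left key (by positivity)
  nlinarith

theorem apply_basis (hs : IsHoppingOperator e σ s A) (j : ℤ) :
    A (e j) = e (j - 1) + (s j : ℂ) • e (j + 1) := by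
  apply e.repr.injective
  ext i
  rw [e.repr_apply_apply, e.repr_apply_apply, hs.inner_apply, inner_add_right, inner_smul_right]
  have ho := orthonormal_iff_ite.1 e.orthonormal
  simp only [ho]
  by_cases h1 : i + 1 = j
  · rw [if_pos h1, if_neg (by omega), if_pos (by omega), if_neg (by omega)]
    simp
  by_cases h2 : i - 1 = j
  · rw [if_neg h1, if_pos h2, if_neg (by omega), if_pos (by omega), h2]
  · rw [if_neg h1, if_neg h2, if_neg (by omega), if_neg (by omega)]
    simp

/-- A truncated plane wave on a window where the subdiagonal is constant. -/
theorem apply_wave (hs : IsHoppingOperator e σ s A) {ω : ℂ} (hω : ω * conj ω = 1) {c : ℝ} {k : ℤ}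
    (n : ℕ) (hk : ∀ j : ℕ, j < n → s (k + j) = c) :
    (conj ω + c * ω) • (∑ j ∈ Finset.range n, conj ω ^ j • e (k + j))
      - A (∑ j ∈ Finset.range n, conj ω ^ j • e (k + j))
    = conj ω ^ n • e (k + n - 1) - e (k - 1)
      + (c * ω : ℂ) • (e k - conj ω ^ n • e (k + n)) := by
  induction n with
  | zero => simp
  | succ n ih =>
    have ih' := ih fun j hj => hk j (by omega)
    rw [Finset.sum_range_succ, map_add A, smul_add, map_smul, hs.apply_basis, hk n (by omega)]
    have h1 : k + ((n + 1 : ℕ) : ℤ) - 1 = k + n := by push_cast; ring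
    have h2 : k + ((n + 1 : ℕ) : ℤ) = k + n + 1 := by push_cast; ring
    rw [h1, h2, add_sub_add_comm, ih']
    have h3 : (c : ℂ) * conj ω ^ n = c * ω * conj ω ^ (n + 1) := by
      rw [pow_succ]; linear_combination -(c : ℂ) * conj ω ^ n * hω
    have h4 : conj ω ^ n • ((c : ℂ) • e (k + n + 1)) = (c * ω * conj ω ^ (n + 1)) • e (k + n + 1) := by
      rw [smul_smul, mul_comm, h3]
    rw [smul_add, h4]
    module

theorem norm_wave_sq (e : HilbertBasis ℤ ℂ EllTwoZ) {ω : ℂ} (hω : ω * conj ω = 1) (k : ℤ) (n : ℕ) :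
    ‖∑ j ∈ Finset.range n, conj ω ^ j • e (k + j)‖ ^ 2 = n := by
  have ho : Orthonormal ℂ fun j : ℕ => e (k + j) :=
    e.orthonormal.comp _ fun a b hab => by simpa using hab
  have h := ho.inner_sum (fun j => conj ω ^ j) (fun j => conj ω ^ j) (Finset.range n)
  simp only [map_pow, Complex.conj_conj, ← mul_pow, hω, one_pow, Finset.sum_const,
    Finset.card_range, nsmul_eq_mul, mul_one] at h
  rw [inner_self_eq_ofReal_norm_sq] at h
  exact_mod_cast h

end IsHoppingOperator

/-! ### Ellipses in the spectrum and the convex hull. -/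

section PseudoErgodic

variable {e : HilbertBasis ℤ ℂ EllTwoZ} {σ : ℝ} {A : EllTwoZ →L[ℂ] EllTwoZ}

/-- The spectrum of a pseudo-ergodic hopping operator contains the ellipses which are the spectra
of the Laurent operators with constant subdiagonal `σ` and `-σ`. -/
theorem ellipse_subset_spectrum (hσ0 : 0 < σ) (hσ1 : σ ≤ 1)
    (hA : A ∈ pseudoErgodic e (-1) 1 (hoppingSets σ)) {ω : ℂ} (hω : ‖ω‖ = 1) {c : ℝ}
    (hc : c = σ ∨ c = -σ) : conj ω + c * ω ∈ spectrum ℂ A := by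
  obtain ⟨s, hs⟩ := exists_isHoppingOperator hA.1
  have hω' : ω * conj ω = 1 := by
    rw [Complex.mul_conj, Complex.normSq_eq_norm_sq, hω]; simp
  by_contra hn
  rw [spectrum.notMem_iff] at hn
  obtain ⟨u, hu⟩ := hn
  set K := ‖((u⁻¹ : (EllTwoZ →L[ℂ] EllTwoZ)ˣ) : EllTwoZ →L[ℂ] EllTwoZ)‖
  have hcn : ‖(c : ℂ) * ω‖ ≤ 1 := by
    rw [norm_mul, hω, mul_one, Complex.norm_real, Real.norm_eq_abs, abs_le]
    rcases hc with rfl | rfl <;> constructor <;> linarith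
  -- The wave has norm `√n`, but only boundary terms, of total norm at most 4, survive in its image;
  -- a bounded inverse would bound `n`.
  have hbound : ∀ n : ℕ, (n : ℝ) ≤ (K * 4) ^ 2 := by
    intro n
    obtain ⟨k, hk⟩ := exists_pattern_of_mem_pseudoErgodic hσ0 hA hs n (c := fun _ => c)
      fun _ => hc
    set f : EllTwoZ := ∑ j ∈ Finset.range n, conj ω ^ j • e (k + j)
    have h1 : ((u⁻¹ : (EllTwoZ →L[ℂ] EllTwoZ)ˣ) : EllTwoZ →L[ℂ] EllTwoZ)
        ((u : EllTwoZ →L[ℂ] EllTwoZ) f) = f := by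
      rw [← mul_apply_eq_comp, Units.inv_mul, one_apply_eq_self]
    have h2 : (u : EllTwoZ →L[ℂ] EllTwoZ) f = conj ω ^ n • e (k + n - 1) - e (k - 1)
        + (c * ω : ℂ) • (e k - conj ω ^ n • e (k + n)) := by
      rw [← hs.apply_wave hω' n hk, hu, sub_apply,
        Algebra.algebraMap_eq_smul_one, smul_apply,
        one_apply_eq_self]
    have he : ∀ j, ‖e j‖ = 1 := e.orthonormal.1
    have hpow : ∀ j, ‖conj ω ^ n • e j‖ = 1 := fun j => by
      rw [norm_smul, he, norm_pow, RCLike.norm_conj, hω]; simp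
    have h3 : ‖(u : EllTwoZ →L[ℂ] EllTwoZ) f‖ ≤ 4 := by
      rw [h2]
      have h4 := norm_sub_le (conj ω ^ n • e (k + n - 1)) (e (k - 1))
      have h5 := norm_sub_le (e k) (conj ω ^ n • e (k + n))
      rw [hpow, he] at h4 h5
      have h6 : ‖(c * ω : ℂ) • (e k - conj ω ^ n • e (k + n))‖ ≤ 1 * 2 := by
        rw [norm_smul]
        exact mul_le_mul hcn (by linarith) (norm_nonneg _) zero_le_one
      refine (norm_add_le _ _).trans ?_
      linarith
    have h7 : ‖f‖ ≤ K * 4 := by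
      rw [← h1]
      exact (ContinuousLinearMap.le_opNorm _ _).trans
        (mul_le_mul_of_nonneg_left h3 (norm_nonneg _))
    rw [← IsHoppingOperator.norm_wave_sq e hω' k n]
    exact pow_le_pow_left₀ (norm_nonneg _) h7 2
  obtain ⟨n, hn⟩ := exists_nat_gt ((K * 4) ^ 2)
  exact absurd (hbound n) (not_le.2 hn)

/-- On the ellipse `Re(wμ) = Re(ω̄(w + c w̄))`, which is largest when `ω` is aligned with `w + c
w̄`. -/
theorem exists_mem_spectrum_re_mul_eq (hσ0 : 0 < σ) (hσ1 : σ ≤ 1)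
    (hA : A ∈ pseudoErgodic e (-1) 1 (hoppingSets σ)) (w : ℂ) {c : ℝ} (hc : c = σ ∨ c = -σ) :
    ∃ μ ∈ spectrum ℂ A, (w * μ).re = ‖w + c * conj w‖ := by
  obtain ⟨ω, hω, h⟩ : ∃ ω : ℂ, ‖ω‖ = 1 ∧ conj ω * (w + c * conj w) = ‖w + c * conj w‖ := by
    generalize w + c * conj w = p
    by_cases hp : p = 0
    · exact ⟨1, by simp, by simp [hp]⟩
    · have hp' : (‖p‖ : ℂ) ≠ 0 := by simpa using hp
      refine ⟨p / ‖p‖, by simp [hp], ?_⟩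
      rw [map_div₀, Complex.conj_ofReal, div_mul_eq_mul_div, mul_comm, Complex.mul_conj,
        Complex.normSq_eq_norm_sq, Complex.ofReal_pow, pow_two, mul_div_assoc, div_self hp',
        mul_one]
  refine ⟨_, ellipse_subset_spectrum hσ0 hσ1 hA hω hc, ?_⟩
  rw [← Complex.ofReal_re ‖w + c * conj w‖, ← h]
  simp
  ring

theorem mem_convexHull_spectrum_of_forall_re_mul_le (hσ0 : 0 < σ) (hσ1 : σ ≤ 1)
    (hA : A ∈ pseudoErgodic e (-1) 1 (hoppingSets σ)) {z : ℂ}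
    (h : ∀ (w : ℂ) (M : ℝ), ‖w + σ * conj w‖ ≤ M → ‖w - σ * conj w‖ ≤ M → (w * z).re ≤ M) :
    z ∈ convexHull ℝ (spectrum ℂ A) := by
  by_contra hz
  obtain ⟨w, hw⟩ := exists_re_mul_lt_of_notMem_convexHull_spectrum hz
  obtain ⟨μ, hμ, hμe⟩ := exists_mem_spectrum_re_mul_eq hσ0 hσ1 hA w (Or.inl rfl)
  obtain ⟨ν, hν, hνe⟩ := exists_mem_spectrum_re_mul_eq hσ0 hσ1 hA w (Or.inr rfl)
  rw [Complex.ofReal_neg, neg_mul, ← sub_eq_add_neg] at hνe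
  have h1 := h w _ (le_max_left _ _) (le_max_right _ _)
  rw [← hμe, ← hνe] at h1
  exact absurd h1 (not_le.2 (max_lt (hw μ hμ) (hw ν hν)))

theorem numRange_eq_convexHull_spectrum (hσ0 : 0 < σ) (hσ1 : σ ≤ 1)
    (hA : A ∈ pseudoErgodic e (-1) 1 (hoppingSets σ)) :
    numRange A = convexHull ℝ (spectrum ℂ A) := by
  obtain ⟨s, hs⟩ := exists_isHoppingOperator hA.1
  exact Set.Subset.antisymm (fun z hz => mem_convexHull_spectrum_of_forall_re_mul_le hσ0 hσ1 hA
    fun w M h1 h2 => hs.re_mul_le_of_mem_numRange h1 h2 hz) (convexHull_spectrum_subset_numRange A)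

theorem sqrtNumRangeSq_subset_numRange (hσ0 : 0 < σ) (hσ1 : σ ≤ 1)
    (hA : A ∈ pseudoErgodic e (-1) 1 (hoppingSets σ)) : sqrtNumRangeSq A ⊆ numRange A := by
  obtain ⟨s, hs⟩ := exists_isHoppingOperator hA.1
  rw [numRange_eq_convexHull_spectrum hσ0 hσ1 hA]
  exact fun z hz => mem_convexHull_spectrum_of_forall_re_mul_le hσ0 hσ1 hA
    fun w M h1 h2 => hs.re_mul_le_of_sq_mem_numRange_sq h1 h2 hz

end PseudoErgodic

/-! ### The strict bound in the direction `1 - i`. -/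

/-- Since `|α| ≥ τ`, the vectors `D` and `αS + βD` cannot both be small compared with `S`. Later `S`
is a row of the Hermitian part and `αS + βD` the skew defect up to phase. -/
theorem sq_mul_add_norm_sq_le {S D β : ℂ} {α τ : ℝ} (hτ0 : 0 ≤ τ) (hτ1 : τ ≤ 1) (hα : τ ≤ |α|)
    (hβ : ‖β‖ ≤ 1) :
    τ ^ 2 / 4 * (‖S‖ ^ 2 + ‖D‖ ^ 2) ≤ ‖D‖ ^ 2 + ‖α * S + β * D‖ ^ 2 := by
  have h1 : τ * ‖S‖ ≤ ‖α * S + β * D‖ + ‖D‖ := by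
    calc τ * ‖S‖ ≤ |α| * ‖S‖ := mul_le_mul_of_nonneg_right hα (norm_nonneg _)
      _ = ‖(α * S + β * D) - β * D‖ := by simp
      _ ≤ ‖α * S + β * D‖ + ‖β * D‖ := norm_sub_le _ _
      _ ≤ _ := by
        rw [norm_mul]
        have := mul_le_mul_of_nonneg_right hβ (norm_nonneg D)
        linarith
  have h2 : (τ * ‖S‖) ^ 2 ≤ (‖α * S + β * D‖ + ‖D‖) ^ 2 :=
    pow_le_pow_left₀ (by positivity) h1 2
  have h3 : τ ^ 2 * ‖D‖ ^ 2 ≤ 1 * ‖D‖ ^ 2 :=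
    mul_le_mul_of_nonneg_right (by nlinarith) (sq_nonneg _)
  nlinarith [sq_nonneg (‖α * S + β * D‖ - ‖D‖), sq_nonneg ‖α * S + β * D‖, sq_nonneg ‖D‖]

section Diagonal

variable {σ s t : ℝ}

/-- In this direction skew and Hermitian coefficients have equal modulus for either sign; only the
real part of their ratio divided by `i` depends on the sign. -/
theorem one_sub_I_sub_mul (hs : s ^ 2 = σ ^ 2) :
    (1 - Complex.I - (1 + Complex.I) * s)
      = Complex.I * ((-2 * s - (1 - σ ^ 2) * Complex.I) / (1 + σ ^ 2))
        * (1 - Complex.I + (1 + Complex.I) * s) := by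
  have hG : (1 + σ ^ 2 : ℂ) ≠ 0 := by
    exact_mod_cast (show (1 + σ ^ 2 : ℝ) ≠ 0 by positivity)
  have hs' : (σ : ℂ) ^ 2 = s ^ 2 := by exact_mod_cast hs.symm
  field_simp
  rw [hs']
  apply Complex.ext
  · simp [pow_two]; ring
  · simp [pow_two]; ring

theorem one_sub_I_mul_sub (ht : t ^ 2 = σ ^ 2) :
    ((1 - Complex.I) * t - (1 + Complex.I))
      = Complex.I * ((-2 * t + (1 - σ ^ 2) * Complex.I) / (1 + σ ^ 2))
        * (1 + Complex.I + (1 - Complex.I) * t) := by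
  have h := congrArg (starRingEnd ℂ) (one_sub_I_sub_mul ht)
  simp only [map_sub, map_mul, map_add, map_one, Complex.conj_I, Complex.conj_ofReal, map_div₀,
    map_neg, map_pow, map_ofNat] at h
  linear_combination -h

theorem norm_sq_one_sub_I_add (hs : s ^ 2 = σ ^ 2) :
    ‖1 - Complex.I + (1 + Complex.I) * s‖ ^ 2 = 2 * (1 + σ ^ 2) := by
  rw [← Complex.normSq_eq_norm_sq, Complex.normSq_apply]
  simp
  linear_combination 2 * hs

theorem norm_sq_one_add_I_add (hs : s ^ 2 = σ ^ 2) :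
    ‖1 + Complex.I + (1 - Complex.I) * s‖ ^ 2 = 2 * (1 + σ ^ 2) := by
  rw [← Complex.normSq_eq_norm_sq, Complex.normSq_apply]
  simp
  linear_combination 2 * hs

/-- Along the bisecting direction the bound on `N(A²)` is strict, row by row. -/
theorem diagonal_row_le (hσ0 : 0 < σ) (hs : s = σ ∨ s = -σ) (ht : t = σ ∨ t = -σ)
    {τ : ℝ} (hτ : τ = σ / (1 + σ ^ 2)) (x y : ℂ) :
    (1 + τ ^ 2) * ‖(1 - Complex.I + (1 + Complex.I) * s) * x
        + (1 + Complex.I + (1 - Complex.I) * t) * y‖ ^ 2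
      - 1 * ‖(1 - Complex.I - (1 + Complex.I) * s) * x + ((1 - Complex.I) * t - (1 + Complex.I)) * y
          - (τ * Complex.I) * ((1 - Complex.I + (1 + Complex.I) * s) * x
            + (1 + Complex.I + (1 - Complex.I) * t) * y)‖ ^ 2
      ≤ (1 + 3 / 4 * τ ^ 2) * 2 * (2 * (1 + σ ^ 2)) * (‖x‖ ^ 2 + ‖y‖ ^ 2) := by
  have hG : 0 < 1 + σ ^ 2 := by positivity
  have hG' : (1 + σ ^ 2 : ℂ) ≠ 0 := by exact_mod_cast hG.ne'
  have hs2 : s ^ 2 = σ ^ 2 := by rcases hs with rfl | rfl <;> ring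
  have ht2 : t ^ 2 = σ ^ 2 := by rcases ht with rfl | rfl <;> ring
  have hτ0 : 0 ≤ τ := by rw [hτ]; positivity
  have hτ1 : τ ≤ 1 := by
    rw [hτ, div_le_one hG]; nlinarith [sq_nonneg (σ - 1)]
  rw [one_sub_I_sub_mul hs2, one_sub_I_mul_sub ht2]
  have hp : ‖(1 - Complex.I + (1 + Complex.I) * s) * x‖ ^ 2 = 2 * (1 + σ ^ 2) * ‖x‖ ^ 2 := by
    rw [norm_mul, mul_pow, norm_sq_one_sub_I_add hs2]
  have hq : ‖(1 + Complex.I + (1 - Complex.I) * t) * y‖ ^ 2 = 2 * (1 + σ ^ 2) * ‖y‖ ^ 2 := by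
    rw [norm_mul, mul_pow, norm_sq_one_add_I_add ht2]
  rw [mul_assoc _ _ x, mul_assoc _ _ y]
  generalize (1 - Complex.I + (1 + Complex.I) * s) * x = p at hp ⊢
  generalize (1 + Complex.I + (1 - Complex.I) * t) * y = q at hq ⊢
  set α : ℝ := -(s + t + σ) / (1 + σ ^ 2) with hα
  set β : ℂ := (((t - s : ℝ) : ℂ) - ((1 - σ ^ 2 : ℝ) : ℂ) * Complex.I) / ((1 + σ ^ 2 : ℝ) : ℂ)
    with hβ
  have hN : ‖Complex.I * ((-2 * s - (1 - σ ^ 2) * Complex.I) / (1 + σ ^ 2)) * p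
      + Complex.I * ((-2 * t + (1 - σ ^ 2) * Complex.I) / (1 + σ ^ 2)) * q
      - (τ * Complex.I) * (p + q)‖ = ‖α * (p + q) + β * (p - q)‖ := by
    rw [← one_mul ‖α * (p + q) + β * (p - q)‖, ← Complex.norm_I, ← norm_mul]
    congr 1
    rw [hα, hβ, hτ]
    push_cast
    field_simp
    ring
  -- `s + t` is `0` or `±2σ`; the shift by `σ` keeps `s + t + σ` at distance at least `σ` from zero.
  -- With `τ = 0` there would be no shift, and alternating signs would give `α = 0`.
  have hαb : τ ≤ |α| := by
    rw [hα, hτ, abs_div, abs_of_pos hG]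
    refine div_le_div_of_nonneg_right ?_ hG.le
    rw [le_abs]
    rcases hs with rfl | rfl <;> rcases ht with rfl | rfl
    · right; linarith
    · right; linarith
    · right; linarith
    · left; linarith
  have hβb : ‖β‖ ≤ 1 := by
    rw [hβ, norm_div, Complex.norm_real, Real.norm_of_nonneg hG.le, div_le_one hG]
    refine le_of_sq_le_sq ?_ hG.le
    rw [← Complex.normSq_eq_norm_sq, Complex.normSq_apply]
    simp only [Complex.sub_re, Complex.sub_im, Complex.ofReal_re, Complex.ofReal_im,
      Complex.mul_re, Complex.mul_im, Complex.I_re, Complex.I_im]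
    rcases hs with hs | hs <;> rcases ht with ht | ht <;> rw [hs, ht] <;> nlinarith [sq_nonneg σ]
  have key := sq_mul_add_norm_sq_le (S := p + q) (D := p - q) hτ0 hτ1 hαb hβb
  have hpar := parallelogram_law_with_norm ℝ p q
  rw [hN]
  nlinarith [mul_nonneg (sq_nonneg τ) (sq_nonneg ‖p - q‖)]

end Diagonal

section PseudoErgodic

variable {e : HilbertBasis ℤ ℂ EllTwoZ} {σ : ℝ} {A : EllTwoZ →L[ℂ] EllTwoZ}

theorem sqrtNumRangeSq_ssubset_numRange (hσ0 : 0 < σ) (hσ1 : σ ≤ 1)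
    (hA : A ∈ pseudoErgodic e (-1) 1 (hoppingSets σ)) : sqrtNumRangeSq A ⊂ numRange A := by
  obtain ⟨s, hs⟩ := exists_isHoppingOperator hA.1
  have hG : 0 < 1 + σ ^ 2 := by positivity
  set h : ℝ := √(2 * (1 + σ ^ 2)) with hh
  have hh2 : h ^ 2 = 2 * (1 + σ ^ 2) := Real.sq_sqrt (by positivity)
  have hh0 : 0 < h := Real.sqrt_pos.2 (by positivity)
  have hhC : (h : ℂ) ≠ 0 := by exact_mod_cast hh0.ne'
  have hh2C : (h : ℂ) ^ 2 = 2 * (1 + σ ^ 2) := by exact_mod_cast hh2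
  have hGC : (1 + σ ^ 2 : ℂ) ≠ 0 := by exact_mod_cast hG.ne'
  set τ : ℝ := σ / (1 + σ ^ 2) with hτ
  have hτ0 : 0 < τ := by positivity
  have hpt : ∀ c : ℝ, c = σ ∨ c = -σ →
      ∃ μ ∈ spectrum ℂ A, (1 - Complex.I) * μ = h * (1 - 2 * c / (1 + σ ^ 2) * Complex.I) := by
    intro c hc
    have hc2 : c ^ 2 = σ ^ 2 := by rcases hc with rfl | rfl <;> ring
    have hc2C : (c : ℂ) ^ 2 = σ ^ 2 := by exact_mod_cast hc2
    -- The contact point of the ellipse with the support line: `ω` is `w + c w̄` normalized, for `w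
    -- = 1 - i`.
    refine ⟨_, ellipse_subset_spectrum hσ0 hσ1 hA
      (ω := (1 - Complex.I + (1 + Complex.I) * c) / h) ?_ hc, ?_⟩
    · rw [norm_div, Complex.norm_real, Real.norm_of_nonneg hh0.le, div_eq_one_iff_eq hh0.ne']
      rw [← sq_eq_sq₀ (norm_nonneg _) hh0.le, norm_sq_one_sub_I_add hc2, hh2]
    · simp only [map_div₀, map_add, map_sub, map_mul, map_one, Complex.conj_I, Complex.conj_ofReal]
      have h1 : (1 - Complex.I) * ((1 - -Complex.I + (1 + -Complex.I) * (c : ℂ)) / h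
          + c * ((1 - Complex.I + (1 + Complex.I) * c) / h))
          = (2 * (1 + (c : ℂ) ^ 2) - 4 * c * Complex.I) / h := by
        field_simp
        linear_combination -(1 - (c : ℂ)) ^ 2 * Complex.I_sq
      rw [h1, hc2C, ← hh2C, div_eq_iff hhC]
      have h2 : (h : ℂ) * (1 - 2 * c / (1 + σ ^ 2) * Complex.I) * h
          = (h : ℂ) ^ 2 - h ^ 2 * (2 * c / (1 + σ ^ 2) * Complex.I) := by ring
      rw [h2, hh2C]
      field_simp
      ring
  obtain ⟨μ, hμ, hμe⟩ := hpt σ (Or.inl rfl)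
  obtain ⟨ν, hν, hνe⟩ := hpt (-σ) (Or.inr rfl)
  -- The contact points have slopes `∓2τ`, so these weights give slope `τ`, the one
  -- `diagonal_row_le` excludes.
  have hz : (1 / 4 : ℝ) • μ + (3 / 4 : ℝ) • ν ∈ numRange A :=
    convex_numRange A (spectrum_subset_numRange A hμ) (spectrum_subset_numRange A hν)
      (by norm_num) (by norm_num) (by norm_num)
  have hwz : (1 - Complex.I) * ((1 / 4 : ℝ) • μ + (3 / 4 : ℝ) • ν) = h * (1 + τ * Complex.I) := by
    simp only [Complex.real_smul]
    push_cast [hτ] at hνe ⊢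
    linear_combination (1 / 4 : ℂ) * hμe + (3 / 4 : ℂ) * hνe
  refine (Set.ssubset_iff_of_subset (sqrtNumRangeSq_subset_numRange hσ0 hσ1 hA)).2
    ⟨_, hz, fun hmem => ?_⟩
  have key := re_mul_le_of_mem_numRange_sq (A := A) (w := 1 - Complex.I) (τ := τ)
    (M := (1 + 3 / 4 * τ ^ 2) * (2 * (1 + σ ^ 2))) (fun f => by
      have := norm_sq_sub_norm_sq_le_of_inner e (a := 1 + τ ^ 2) (b := 1)
        (C := (1 + 3 / 4 * τ ^ 2) * 2 * (2 * (1 + σ ^ 2)))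
        (u := (1 - Complex.I) • A f + conj (1 - Complex.I) • ContinuousLinearMap.adjoint A f)
        (v := (1 - Complex.I) • A f - conj (1 - Complex.I) • ContinuousLinearMap.adjoint A f
          - (τ * Complex.I) • ((1 - Complex.I) • A f
            + conj (1 - Complex.I) • ContinuousLinearMap.adjoint A f)) (f := f) (fun i => by
          rw [inner_sub_right, inner_smul_right _ _ (τ * Complex.I), hs.inner_skew_part,
            hs.inner_hermitian_part]
          have hconj : conj (1 - Complex.I) = 1 + Complex.I := by simp
          rw [hconj]
          exact diagonal_row_le hσ0 (hs.sign i) (hs.sign (i - 1)) hτ _ _)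
      rw [one_mul] at this
      exact this.trans_eq (by ring)) hmem
  rw [← mul_pow, hwz] at key
  have hre : ((1 - τ * Complex.I) * (h * (1 + τ * Complex.I)) ^ 2).re = (1 + τ ^ 2) * h ^ 2 := by
    simp [pow_two]
    ring
  rw [hre, hh2] at key
  have := le_of_mul_le_mul_right key (by positivity)
  nlinarith

theorem not_convex_spectrum (hσ0 : 0 < σ) (hσ1 : σ ≤ 1)
    (hA : A ∈ pseudoErgodic e (-1) 1 (hoppingSets σ)) : ¬ Convex ℝ (spectrum ℂ A) := by
  intro hconv
  have h := sqrtNumRangeSq_ssubset_numRange hσ0 hσ1 hA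
  rw [numRange_eq_convexHull_spectrum hσ0 hσ1 hA, hconv.convexHull_eq] at h
  exact h.not_subset (spectrum_subset_sqrtNumRangeSq A)

end PseudoErgodic

/-! ### Almost sure pseudo-ergodicity. -/

section Random

variable {Ω : Type*} [MeasurableSpace Ω] {P : Measure Ω}

/-- An i.i.d. family indexed by `ℤ` almost surely contains a given finite pattern whose letters
all have positive probability. -/
theorem ae_exists_pattern [IsProbabilityMeasure P] {X : ℤ → Ω → ℂ} (hm : ∀ i, Measurable (X i))
    (hi : iIndepFun X P) (hd : ∀ i, IdentDistrib (X i) (X 0) P P) (N : ℕ) (c : Fin N → ℂ)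
    (hc : ∀ j, 0 < P (X 0 ⁻¹' {c j})) : ∀ᵐ ω ∂P, ∃ k : ℤ, ∀ j : Fin N, X (k + j) ω = c j := by
  -- Consecutive disjoint windows of length `N` make the events of seeing the pattern independent
  -- with a common positive probability, as the second Borel–Cantelli lemma requires.
  let g : ℕ × Fin N → ℤ := fun p => (N : ℤ) * p.1 + p.2
  have hg : Function.Injective g := by
    rintro ⟨m, i⟩ ⟨n, j⟩ h
    have h' : N * m + i = N * n + j := by
      have h2 : (N : ℤ) * m + (i : ℕ) = N * n + (j : ℕ) := h
      exact_mod_cast h2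
    have hN : 0 < N := i.pos
    have h1 : m = n := by
      have := congrArg (· / N) h'
      simpa [Nat.mul_add_div hN, Nat.div_eq_of_lt i.2, Nat.div_eq_of_lt j.2] using this
    subst h1
    rw [Prod.mk.injEq]
    exact ⟨rfl, Fin.ext (by omega)⟩
  have hY := hi.precomp hg
  let S : ℕ → Set Ω := fun m => ⋂ j, X (g (m, j)) ⁻¹' {c j}
  have hprob : ∀ m j, P (X (g (m, j)) ⁻¹' {c j}) = P (X 0 ⁻¹' {c j}) := fun m j =>
    (hd _).measure_mem_eq (measurableSet_singleton _)
  have hSprob : ∀ m, P (S m) = ∏ j, P (X 0 ⁻¹' {c j}) := by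
    intro m
    have hZ := hY.precomp (Prod.mk_right_injective (β := Fin N) m)
    have := hZ.meas_iInter (s := fun j => X (g (m, j)) ⁻¹' {c j})
      fun j => ⟨{c j}, measurableSet_singleton _, rfl⟩
    simpa only [hprob] using this
  have hSm : ∀ m, MeasurableSet (S m) := fun m =>
    MeasurableSet.iInter fun j => hm _ (measurableSet_singleton _)
  have hSi : iIndepSet S P := by
    rw [iIndepSet_iff_meas_biInter hSm]
    intro T
    have h1 := hY.meas_biInter (S := T ×ˢ Finset.univ) (s := fun p => X (g p) ⁻¹' {c p.2})
      fun p _ => ⟨{c p.2}, measurableSet_singleton _, rfl⟩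
    have h2 : ⋂ p ∈ T ×ˢ (Finset.univ : Finset (Fin N)), X (g p) ⁻¹' {c p.2} = ⋂ m ∈ T, S m := by
      ext ω
      simp only [S, Set.mem_iInter, Finset.mem_product, Finset.mem_univ, and_true]
      exact ⟨fun h m hm j => h (m, j) hm, fun h p hp => h p.1 hp p.2⟩
    rw [h2, Finset.prod_product] at h1
    rw [h1]
    refine Finset.prod_congr rfl fun m _ => ?_
    rw [hSprob]
    exact Finset.prod_congr rfl fun j _ => hprob m j
  have hsum : ∑' m, P (S m) = ⊤ := by
    simp only [hSprob]
    exact ENNReal.tsum_const_eq_top_of_ne_zero (Finset.prod_ne_zero_iff.2 fun j _ => (hc j).ne')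
  have hlim := measure_limsup_eq_one hSm hSi hsum
  filter_upwards [(mem_ae_iff_prob_eq_one (MeasurableSet.measurableSet_limsup hSm)).2 hlim] with ω hω
  obtain ⟨m, hm⟩ := (Filter.mem_limsup_iff_frequently_mem.1 hω).exists
  exact ⟨N * m, fun j => Set.mem_iInter.1 hm j⟩

theorem IsRandomHoppingMatrix.ae_mem_pseudoErgodic [IsProbabilityMeasure P]
    {e : HilbertBasis ℤ ℂ EllTwoZ} {σ : ℝ} {A : Ω → EllTwoZ →L[ℂ] EllTwoZ}
    (hA : IsRandomHoppingMatrix e σ P A) :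
    ∀ᵐ ω ∂P, A ω ∈ pseudoErgodic e (-1) 1 (hoppingSets σ) := by
  -- Boolean words encode the sign patterns, so that only countably many null sets are united.
  have h : ∀ᵐ ω ∂P, ∀ (N : ℕ) (b : Fin N → Bool), ∃ k : ℤ, ∀ j : Fin N,
      matrixEntry e (A ω) (k + j + 1) (k + j) = if b j then (σ : ℂ) else -(σ : ℂ) := by
    rw [ae_all_iff]
    intro N
    rw [ae_all_iff]
    intro b
    refine ae_exists_pattern (X := fun j ω => matrixEntry e (A ω) (j + 1) j)
      hA.measurable_entry hA.indep hA.identDistrib N _ fun j => ?_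
    split_ifs
    · exact hA.pos_prob
    · exact hA.neg_prob
  filter_upwards [h] with ω hω
  refine mem_pseudoErgodic_of_exists_pattern (hA.mem ω) fun N c hc => ?_
  classical
  obtain ⟨k, hk⟩ := hω N fun j => decide (c j = σ)
  refine ⟨k, fun j => ?_⟩
  rw [hk j]
  by_cases h : c j = σ
  · simp [h]
  · rw [if_neg (by simpa using h), (hc j).resolve_left h]

end Random

theorem mainTheorem8 (σ : ℝ) (hσ0 : 0 < σ) (hσ1 : σ ≤ 1) (e : HilbertBasis ℤ ℂ EllTwoZ) :
    (∀ A ∈ pseudoErgodic e (-1) 1 (hoppingSets σ),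
      sqrtNumRangeSq A ⊂ numRange A ∧
      spectrum ℂ A ⊆ sqrtNumRangeSq A ∧
      numRange A = convexHull ℝ (spectrum ℂ A) ∧
      ¬ Convex ℝ (spectrum ℂ A)) ∧
    (∀ (Ω : Type*) [MeasurableSpace Ω] (P : Measure Ω) [IsProbabilityMeasure P]
      (A : Ω → EllTwoZ →L[ℂ] EllTwoZ), IsRandomHoppingMatrix e σ P A →
      ∀ᵐ ω ∂P, ¬ Convex ℝ (spectrum ℂ (A ω))) := by
  refine ⟨fun A hA => ⟨sqrtNumRangeSq_ssubset_numRange hσ0 hσ1 hA,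
    spectrum_subset_sqrtNumRangeSq A, numRange_eq_convexHull_spectrum hσ0 hσ1 hA,
    not_convex_spectrum hσ0 hσ1 hA⟩, fun Ω _ P _ A hA => ?_⟩
  filter_upwards [hA.ae_mem_pseudoErgodic] with ω hω
  exact not_convex_spectrum hσ0 hσ1 hω
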